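/- For $N\ge 1$ let $D_N=\mathbb Z_N\rtimes\mathbb Z_2$ be the dihedral group of order $2N$, where the non-trivial element of $\mathbb Z_2$ acts on $\mathbb Z_N$ by $a\mapsto -a$. A function $\gamma:D_N\to R$ into a finite set $R$ fulfills the subgroup promise with respect to a subgroup $H\le D_N$ if it is constant and distinct on the left cosets of $H$, that is, $\gamma(x)=\gamma(y)\iff x^{-1}y\in H$ for all $x,y\in D_N$. An evaluation of $\gamma$ is one application of a unitary operator $U_\gamma$ on $\mathbb C^{D_N}\otimes\mathbb C^{R}$ with $U_\gamma|g\rangle|r_0\rangle=|g\rangle|\gamma(g)\rangle$ for all $g\in D_N$, where $r_0\in R$ is a fixed label for the blank state of the answer register. A quantum query algorithm starts in a computational basis state of $\mathbb C^{D_N}\otimes\mathbb C^{R}\otimes\mathbb C^{W}$ with a finite workspace $W$, alternates fixed unitary operators that do not depend on $\gamma$ with applications of $U_\gamma\otimes I$, measures in the computational basis, and outputs a fixed function of the outcome. Theorem. There is a function $q:\mathbb N\to\mathbb N$ with $q(N)=\Theta(\log N)$ such that for every $N\ge 1$, every finite set $R$ and every $r_0\in R$ there is a quantum query algorithm that makes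 exactly $q(N)$ evaluations, outputs a subset $X\subseteq D_N$, and has the following property: for every subgroup $H\le D_N$, every function $\gamma:D_N\to R$ that fulfills the subgroup promise with respect to $H$, and every unitary operator $U_\gamma$ as above, the output $X$ is a generating set for $H$ with probability at least $1-\frac2N$. -/

import Mathlib

open scoped Kronecker Matrix

/-- `γ` is constant and distinct on the left cosets of `H`:
two elements have the same value exactly when they lie in the same left coset of `H`. -/
def HidesSubgroup {G R : Type*} [Group G] (γ : G → R) (H : Subgroup G) : Prop :=
  ∀ x y : G, γ x = γ y ↔ x⁻¹ * y ∈ H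

/-- `U` is an evaluation oracle for `γ`, acting on an input register with basis `G` and an answer
register with basis `R` whose blank state is `r₀`: it is unitary and maps `|g⟩|r₀⟩` to
`|g⟩|γ g⟩`.  Its action on basis states with a non-blank answer register is unconstrained. -/
def IsEvaluationOracle {G R : Type*} [Fintype G] [DecidableEq G] [Fintype R] [DecidableEq R]
    (γ : G → R) (r₀ : R) (U : Matrix (G × R) (G × R) ℂ) : Prop :=
  U ∈ Matrix.unitaryGroup (G × R) ℂ ∧
    ∀ g : G, U *ᵥ Pi.single (g, r₀) 1 = Pi.single (g, γ g) 1

/-- A quantum query algorithm with outputs in `O`.  Its state space has the computational basis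
`(G × R) × work`: the input and answer registers on which the oracle acts, and a finite
workspace.  It starts in a basis state, applies the unitaries
`gate 0, oracle, gate 1, oracle, …, oracle, gate queries` in this order, measures in the
computational basis, and applies the classical map `out` to the outcome.
(The values `gate k` with `k > queries` are not used.) -/
structure QuantumQueryAlgorithm.{u} (G : Type) (R : Type u) (O : Type)
    [Fintype G] [DecidableEq G] [Fintype R] [DecidableEq R] where
  work : Type u
  [fintypeWork : Fintype work]
  [decEqWork : DecidableEq work]
  queries : ℕ
  start : (G × R) × work
  gate : ℕ → Matrix.unitaryGroup ((G × R) × work) ℂ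
  out : (G × R) × work → O

namespace QuantumQueryAlgorithm

universe u

attribute [instance] fintypeWork decEqWork

variable {G : Type} {R : Type u} {O : Type}
  [Fintype G] [DecidableEq G] [Fintype R] [DecidableEq R]

/-- The state after `k` evaluations of the oracle `U`, each followed by its gate. -/
def state (A : QuantumQueryAlgorithm G R O) (U : Matrix (G × R) (G × R) ℂ) :
    ℕ → ((G × R) × A.work → ℂ)
  | 0 => (A.gate 0).1 *ᵥ Pi.single A.start 1
  | k + 1 => (A.gate (k + 1)).1 *ᵥ
      ((U ⊗ₖ (1 : Matrix A.work A.work ℂ)) *ᵥ A.state U k)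

/-- The probability that the output of `A`, run with the oracle `U`, lies in `E`. -/
noncomputable def prob (A : QuantumQueryAlgorithm G R O) (U : Matrix (G × R) (G × R) ℂ)
    (E : Set O) : ℝ :=
  ∑ i, (A.out ⁻¹' E).indicator (fun i => ‖A.state U A.queries i‖ ^ 2) i

end QuantumQueryAlgorithm

/-! Each evaluation on a uniform input with blank answer register yields one copy of the graph state
of `γ`; let `φ` be the product of `m` copies. For a subgroup `K` consider the states invariant under
right translation by `K` in each register. If `K = H`, they contain `φ`. If `K` is not contained in
`H`, pick `k` in `K` outside `H`: the `2 ^ m` translates of `φ` by `1` or `k` in each register are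
orthonormal but indistinguishable to invariant states, so Bessel bounds the projection of `φ` by `2
^ (-m / 2)` (`HidesSubgroup.norm_starProjection_le`). Test all subgroups in order of decreasing size
and report the first success. Everything tested before `H` is not contained in `H`, so these tests
barely disturb `φ`, and the test for `H` succeeds with error at most `2 * n * 2 ^ (-m / 2)`, where
`n` counts the subgroups (`one_sub_le_norm_sq_sequentialKraus`). A dihedral group has at most `(2 *
N) ^ 2` subgroups, so logarithmic `m` suffices. -/

/-! ### Unitary matrices extending isometries -/

/-- Any two isometric embeddings of a space into `ℂⁿ` are intertwined by a unitary matrix. -/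
theorem exists_unitary_mulVec_eq {n E : Type*} [Fintype n] [DecidableEq n]
    [NormedAddCommGroup E] [InnerProductSpace ℂ E] (J T : E →ₗᵢ[ℂ] EuclideanSpace ℂ n) :
    ∃ W : Matrix.unitaryGroup n ℂ, ∀ e, W.1 *ᵥ (J e).ofLp = (T e).ofLp := by
  set L : EuclideanSpace ℂ n →ₗᵢ[ℂ] EuclideanSpace ℂ n :=
    (T.comp J.equivRange.symm.toLinearIsometry).extend with hL
  have hLJ : ∀ e, L (J e) = T e := by
    intro e
    have h := LinearIsometry.extend_apply (T.comp J.equivRange.symm.toLinearIsometry)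
      (J.equivRange e)
    have h2 : ((J.equivRange e : J.range) : EuclideanSpace ℂ n) = J e := rfl
    rw [h2] at h
    rw [hL, h]
    simp
  let M : Matrix n n ℂ := Matrix.of fun i j => L (EuclideanSpace.single j 1) i
  have hM : M ∈ Matrix.unitaryGroup n ℂ := by
    rw [Matrix.mem_unitaryGroup_iff']
    ext i j
    have h := L.inner_map_map (EuclideanSpace.single i (1 : ℂ)) (EuclideanSpace.single j (1 : ℂ))
    rw [PiLp.inner_apply] at h
    simp only [EuclideanSpace.inner_single_left, map_one, one_mul] at h
    rw [Matrix.mul_apply, Matrix.one_apply]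
    simp only [Matrix.star_apply, M, Matrix.of_apply]
    convert h using 1
    · refine Finset.sum_congr rfl fun k _ => ?_
      simp [mul_comm]
    · simp
  refine ⟨⟨M, hM⟩, fun e => ?_⟩
  rw [← hLJ e]
  have hsum : J e = ∑ j, (J e) j • EuclideanSpace.single j (1 : ℂ) := by
    ext i
    simp [Pi.single_apply]
  ext i
  conv_rhs => rw [hsum, map_sum]
  simp [Matrix.mulVec, dotProduct, M, mul_comm]

/-- Permuting the coordinates is a unitary operation. -/
theorem exists_unitary_mulVec_comp {n : Type*} [Fintype n] [DecidableEq n] (σ : Equiv.Perm n) :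
    ∃ W : Matrix.unitaryGroup n ℂ, ∀ v : n → ℂ, W.1 *ᵥ v = v ∘ σ := by
  obtain ⟨W, hW⟩ := exists_unitary_mulVec_eq (LinearIsometry.id (R := ℂ) (E := EuclideanSpace ℂ n))
    (LinearIsometryEquiv.piLpCongrLeft 2 ℂ ℂ σ.symm).toLinearIsometry
  refine ⟨W, fun v => ?_⟩
  have h := hW (WithLp.toLp 2 v)
  refine h.trans ?_
  ext i
  simp [Equiv.piCongrLeft']

/-- A unit vector is the image of any basis vector under some unitary matrix. -/
theorem exists_unitary_mulVec_single {n : Type*} [Fintype n] [DecidableEq n] (i : n) (v : n → ℂ)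
    (hv : ∑ j, ‖v j‖ ^ 2 = 1) :
    ∃ W : Matrix.unitaryGroup n ℂ, W.1 *ᵥ Pi.single i 1 = v := by
  have hv' : ‖(WithLp.toLp 2 v : EuclideanSpace ℂ n)‖ = 1 := by
    rw [EuclideanSpace.norm_eq]
    simp [hv]
  obtain ⟨W, hW⟩ := exists_unitary_mulVec_eq
    (LinearIsometry.toSpanSingleton ℂ (EuclideanSpace ℂ n)
      (v := EuclideanSpace.single i 1) (by simp))
    (LinearIsometry.toSpanSingleton ℂ (EuclideanSpace ℂ n) hv')
  refine ⟨W, ?_⟩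
  have h := hW 1
  simpa using h

/-! ### Sequential measurement -/

section Sequential

variable {E : Type*} [NormedAddCommGroup E] [InnerProductSpace ℂ E] [FiniteDimensional ℂ E]

/-- The unnormalised state after the projective tests for `S 0, …, S (j - 1)` have all failed. -/
noncomputable def sequentialResidual (S : ℕ → Submodule ℂ E) : ℕ → E →ₗ[ℂ] E
  | 0 => LinearMap.id
  | j + 1 => (S j)ᗮ.starProjection.toLinearMap ∘ₗ sequentialResidual S j

/-- The Kraus operators of the sequential measurement with `n` tests: outcome `j < n` means that
`S j` is the first test that succeeds, outcome `n` that all of them fail. -/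
noncomputable def sequentialKraus (S : ℕ → Submodule ℂ E) (n j : ℕ) : E →ₗ[ℂ] E :=
  if j < n then (S j).starProjection.toLinearMap ∘ₗ sequentialResidual S j
  else sequentialResidual S j

/-- Pythagoras splits the residual at each test into a success and a failure part, and the sum
telescopes. -/
theorem sum_norm_sq_sequentialKraus (S : ℕ → Submodule ℂ E) (n : ℕ) (x : E) :
    ∑ j : Fin (n + 1), ‖sequentialKraus S n j x‖ ^ 2 = ‖x‖ ^ 2 := by
  have key : ∀ n, ∑ j ∈ Finset.range n, ‖(S j).starProjection (sequentialResidual S j x)‖ ^ 2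
      + ‖sequentialResidual S n x‖ ^ 2 = ‖x‖ ^ 2 := by
    intro n
    induction n with
    | zero => simp [sequentialResidual]
    | succ n ih =>
      rw [Finset.sum_range_succ, ← ih,
        Submodule.norm_sq_eq_add_norm_sq_starProjection (sequentialResidual S n x) (S n)]
      simp [sequentialResidual, add_assoc]
  rw [← key n, Fin.sum_univ_eq_sum_range (fun j => ‖sequentialKraus S n j x‖ ^ 2),
    Finset.sum_range_succ]
  congr 1
  · refine Finset.sum_congr rfl fun j hj => ?_
    simp [sequentialKraus, Finset.mem_range.mp hj]
  · simp [sequentialKraus]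

/-- A failed test is a contraction, so it does not enlarge the earlier deviation; it adds at most
`ε` of its own. -/
theorem norm_sequentialResidual_sub_le (S : ℕ → Submodule ℂ E) (x : E) (ε : ℝ) (j : ℕ)
    (h : ∀ i < j, ‖(S i).starProjection x‖ ≤ ε) :
    ‖sequentialResidual S j x - x‖ ≤ j * ε := by
  induction j with
  | zero => simp [sequentialResidual]
  | succ j ih =>
    have ih := ih fun i hi => h i (by omega)
    have hx : sequentialResidual S (j + 1) x - x
        = (S j)ᗮ.starProjection (sequentialResidual S j x - x) - (S j).starProjection x := by
      have : (S j)ᗮ.starProjection x = x - (S j).starProjection x := by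
        rw [Submodule.starProjection_orthogonal]; simp
      rw [map_sub, this]
      simp [sequentialResidual]
      abel
    rw [hx]
    refine (norm_sub_le _ _).trans ?_
    have h1 := (S j)ᗮ.norm_starProjection_apply_le (sequentialResidual S j x - x)
    have h2 := h j (by omega)
    push_cast
    linarith

/-- A unit vector in `S j` that is almost orthogonal to the spaces tested before `S j` yields the
outcome `j` with high probability. -/
theorem one_sub_le_norm_sq_sequentialKraus (S : ℕ → Submodule ℂ E) (x : E) (hx : ‖x‖ = 1) (ε : ℝ)
    {n j : ℕ} (hj : j < n) (hxj : x ∈ S j) (h : ∀ i < j, ‖(S i).starProjection x‖ ≤ ε) :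
    1 - 2 * (j * ε) ≤ ‖sequentialKraus S n j x‖ ^ 2 := by
  have h1 := norm_sequentialResidual_sub_le S x ε j h
  have h2 : sequentialKraus S n j x
      = x + (S j).starProjection (sequentialResidual S j x - x) := by
    rw [map_sub, Submodule.starProjection_eq_self_iff.mpr hxj]
    simp [sequentialKraus, hj]
  have h3 := (S j).norm_starProjection_apply_le (sequentialResidual S j x - x)
  have h4 : ‖x‖ - ‖(S j).starProjection (sequentialResidual S j x - x)‖
      ≤ ‖sequentialKraus S n j x‖ := by
    rw [h2]
    exact norm_sub_le_norm_add _ _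
  rw [hx] at h4
  have h5 : 1 - j * ε ≤ ‖sequentialKraus S n j x‖ := by linarith
  -- `v ^ 2 ≥ 2 * v - 1` holds for every real `v`, so no bound on `j * ε` is needed.
  nlinarith [sq_nonneg (‖sequentialKraus S n j x‖ - 1)]

/-- If all members of a finite orthonormal family have the same inner products with `S` as `x`,
then the projection of `x` to `S` is small. -/
theorem card_mul_norm_sq_starProjection_le {ι : Type*} [Fintype ι] (S : Submodule ℂ E) (x : E)
    (ψ : ι → E) (hψ : Orthonormal ℂ ψ) (h : ∀ i, ∀ y ∈ S, inner ℂ (ψ i) y = inner ℂ x y) :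
    Fintype.card ι * ‖S.starProjection x‖ ^ 2 ≤ 1 := by
  -- Bessel for the projection `Px`: every inner product equals `‖Px‖ ^ 2`, so `card * ‖Px‖ ^ 4 ≤
  -- ‖Px‖ ^ 2`.
  have hB := hψ.sum_inner_products_le (S.starProjection x) (s := Finset.univ)
  have hx : inner ℂ x (S.starProjection x) = ((‖S.starProjection x‖ ^ 2 : ℝ) : ℂ) := by
    have : S.starProjection x = S.starProjection (S.starProjection x) :=
      (Submodule.starProjection_eq_self_iff.mpr (S.starProjection_apply_mem x)).symm
    rw [this, ← Submodule.inner_starProjection_left_eq_right, ← this, inner_self_eq_norm_sq_to_K]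
    simp
  simp only [h _ _ (S.starProjection_apply_mem x), hx, Complex.norm_real, norm_pow, norm_norm,
    Finset.sum_const, Finset.card_univ, nsmul_eq_mul] at hB
  rcases (sq_nonneg ‖S.starProjection x‖).eq_or_lt with h0 | h0
  · rw [← h0]; simp
  · refine le_of_mul_le_mul_right ?_ h0
    linarith

end Sequential

/-! ### States of the registers -/

/-- The isometry attached to Kraus operators `L a`, with the outcome `a` recorded in a register
and the state `b` in a further register. -/
noncomputable def krausIsometry {B ι A : Type*} [Fintype B] [Fintype ι] [Fintype A] (b : B → ℂ)
    (hb : ∑ y, ‖b y‖ ^ 2 = 1) (L : A → EuclideanSpace ℂ ι →ₗ[ℂ] EuclideanSpace ℂ ι)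
    (hL : ∀ x, ∑ a, ‖L a x‖ ^ 2 = ‖x‖ ^ 2) :
    EuclideanSpace ℂ ι →ₗᵢ[ℂ] EuclideanSpace ℂ (B × (ι × A)) where
  toFun x := WithLp.toLp 2 fun z => b z.1 * L z.2.2 x z.2.1
  map_add' x y := by
    ext z
    simp [mul_add]
  map_smul' c x := by
    ext z
    simp [mul_left_comm]
  norm_map' x := by
    rw [← sq_eq_sq₀ (norm_nonneg _) (norm_nonneg _), ← hL x, EuclideanSpace.norm_sq_eq]
    simp only [LinearMap.coe_mk, AddHom.coe_mk, norm_mul, mul_pow, Fintype.sum_prod_type,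
      ← Finset.mul_sum, ← Finset.sum_mul]
    rw [hb, one_mul, Finset.sum_comm]
    simp only [EuclideanSpace.norm_sq_eq]

theorem krausIsometry_apply {B ι A : Type*} [Fintype B] [Fintype ι] [Fintype A] (b : B → ℂ)
    (hb : ∑ y, ‖b y‖ ^ 2 = 1) (L : A → EuclideanSpace ℂ ι →ₗ[ℂ] EuclideanSpace ℂ ι)
    (hL : ∀ x, ∑ a, ‖L a x‖ ^ 2 = ‖x‖ ^ 2) (x : EuclideanSpace ℂ ι) (z : B × (ι × A)) :
    krausIsometry b hb L hL x z = b z.1 * L z.2.2 x z.2.1 := rfl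

section States

variable {G R B : Type*} {m : ℕ}

/-- The state of `m` registers that are prepared independently. -/
noncomputable def productState (f : Fin m → B → ℂ) : EuclideanSpace ℂ (Fin m → B) :=
  WithLp.toLp 2 fun s => ∏ i, f i (s i)

theorem productState_apply (f : Fin m → B → ℂ) (s : Fin m → B) :
    productState f s = ∏ i, f i (s i) := rfl

theorem norm_productState [Fintype B] (f : Fin m → B → ℂ) (hf : ∀ i, ∑ y, ‖f i y‖ ^ 2 = 1) :
    ‖productState f‖ = 1 := by
  rw [← sq_eq_sq₀ (norm_nonneg _) zero_le_one, EuclideanSpace.norm_sq_eq]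
  simp only [productState_apply, norm_prod, ← Finset.prod_pow]
  rw [← Fintype.prod_sum (fun i y => ‖f i y‖ ^ 2)]
  simp [hf]

/-- The uniform superposition of the pairs `|g⟩|γ g⟩`. -/
noncomputable def graphState [Fintype G] [DecidableEq R] (γ : G → R) (x : G × R) : ℂ :=
  if γ x.1 = x.2 then ((√(Fintype.card G) : ℝ) : ℂ)⁻¹ else 0

theorem sum_norm_sq_graphState [Fintype G] [Nonempty G] [Fintype R] [DecidableEq R] (γ : G → R) :
    ∑ x, ‖graphState γ x‖ ^ 2 = 1 := by
  have h : ∀ x : G × R, ‖graphState γ x‖ ^ 2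
      = if γ x.1 = x.2 then (Fintype.card G : ℝ)⁻¹ else 0 := by
    intro x
    unfold graphState
    split_ifs
    · simp [abs_of_nonneg (Real.sqrt_nonneg _)]
    · simp
  simp [h, Fintype.sum_prod_type]

theorem graphState_eq_sum [Fintype G] [DecidableEq G] [DecidableEq R] (γ : G → R) :
    graphState γ = ∑ g, ((√(Fintype.card G) : ℝ) : ℂ)⁻¹ • Pi.single (g, γ g) (1 : ℂ) := by
  ext ⟨g, r⟩
  simp only [Finset.sum_apply, Pi.smul_apply, Pi.single_apply, Prod.mk.injEq, smul_eq_mul,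
    mul_ite, mul_one, mul_zero, graphState]
  rw [Finset.sum_eq_single g]
  · simp [eq_comm]
  · intro h _ hg
    simp [Ne.symm hg]
  · simp

/-- The oracle is only ever applied to a blank answer register, so its action on other basis states
is irrelevant. -/
theorem IsEvaluationOracle.mulVec_graphState [Fintype G] [DecidableEq G] [Fintype R]
    [DecidableEq R] {γ : G → R} {r₀ : R} {U : Matrix (G × R) (G × R) ℂ}
    (hU : IsEvaluationOracle γ r₀ U) :
    U *ᵥ graphState (fun _ => r₀) = graphState γ := by
  rw [graphState_eq_sum, graphState_eq_sum, Matrix.mulVec_sum]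
  simp only [Matrix.mulVec_smul, hU.2]

/-- The query register in state `f`, the storage registers in states `F i`, and the outcome
register in the basis state `a₀`. -/
def registerState {A : Type*} [DecidableEq A] (a₀ : A) (f : B → ℂ) (F : Fin m → B → ℂ)
    (z : B × ((Fin m → B) × A)) : ℂ :=
  f z.1 * ((∏ i, F i (z.2.1 i)) * if z.2.2 = a₀ then 1 else 0)

theorem kronecker_mulVec_registerState {A : Type*} [Fintype A] [DecidableEq A] [Fintype B]
    [DecidableEq B] (a₀ : A) (f : B → ℂ) (F : Fin m → B → ℂ) (U : Matrix B B ℂ) :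
    (U ⊗ₖ (1 : Matrix ((Fin m → B) × A) ((Fin m → B) × A) ℂ)) *ᵥ registerState a₀ f F
      = registerState a₀ (U *ᵥ f) F := by
  ext ⟨y, w⟩
  rw [Matrix.mulVec, dotProduct, Fintype.sum_prod_type]
  simp only [Matrix.kroneckerMap_apply, Matrix.one_apply, registerState, Matrix.mulVec, dotProduct,
    Finset.sum_mul]
  refine Finset.sum_congr rfl fun x _ => ?_
  rw [Finset.sum_eq_single w]
  · rw [if_pos rfl, mul_one, mul_assoc]
  · intro w' _ hw
    rw [if_neg hw.symm, mul_zero, zero_mul]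
  · simp

/-- Exchange the query register with storage register `i`. -/
def swapRegister (A : Type*) (i : Fin m) : Equiv.Perm (B × ((Fin m → B) × A)) :=
  Function.Involutive.toPerm
    (fun z => (z.2.1 i, (Function.update z.2.1 i z.1, z.2.2)))
    (fun z => by simp)

theorem swapRegister_apply (A : Type*) (i : Fin m) (z : B × ((Fin m → B) × A)) :
    swapRegister A i z = (z.2.1 i, (Function.update z.2.1 i z.1, z.2.2)) := rfl

/-- Swapping stores an answered query and fetches a fresh blank input for the next evaluation. -/
theorem registerState_comp_swapRegister {A : Type*} [DecidableEq A] (a₀ : A) (f : B → ℂ)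
    (F : Fin m → B → ℂ) (i : Fin m) :
    registerState a₀ f F ∘ swapRegister A i = registerState a₀ (F i) (Function.update F i f) := by
  ext ⟨y, s, a⟩
  have h1 : ∏ j, F j (Function.update s i y j)
      = F i y * ∏ j ∈ Finset.univ.erase i, F j (s j) := by
    rw [← Finset.mul_prod_erase _ _ (Finset.mem_univ i), Function.update_self]
    congr 1
    refine Finset.prod_congr rfl fun j hj => ?_
    rw [Function.update_of_ne (Finset.ne_of_mem_erase hj)]
  have h2 : ∏ j, Function.update F i f j (s j)
      = f (s i) * ∏ j ∈ Finset.univ.erase i, F j (s j) := by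
    rw [← Finset.mul_prod_erase _ _ (Finset.mem_univ i), Function.update_self]
    congr 1
    refine Finset.prod_congr rfl fun j hj => ?_
    rw [Function.update_of_ne (Finset.ne_of_mem_erase hj)]
  simp only [Function.comp_apply, swapRegister_apply, registerState, h1, h2]
  rw [mul_assoc, mul_assoc]
  exact mul_left_comm _ _ _

end States

/-! ### Invariant states -/

section Invariant

variable {G : Type*} [Group G]

/-- Right translation of the group elements in `m` registers. -/
def rightShift (R : Type*) {m : ℕ} (t : Fin m → G) : Equiv.Perm (Fin m → G × R) :=
  Equiv.piCongrRight fun i => (Equiv.mulRight (t i)).prodCongr (Equiv.refl R)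

theorem rightShift_apply {R : Type*} {m : ℕ} (t : Fin m → G) (s : Fin m → G × R) (i : Fin m) :
    rightShift R t s i = ((s i).1 * t i, (s i).2) := rfl

/-- The states of `m` registers that are invariant under right translation by `K`
in each register. -/
def invariantStates (R : Type*) (m : ℕ) (K : Subgroup G) :
    Submodule ℂ (EuclideanSpace ℂ (Fin m → G × R)) where
  carrier := {x | ∀ t : Fin m → G, (∀ i, t i ∈ K) → ∀ s, x (rightShift R t s) = x s}
  zero_mem' := by simp
  add_mem' hx hy t ht s := by simp [hx t ht s, hy t ht s]
  smul_mem' c x hx t ht s := by simp [hx t ht s]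

variable [Fintype G] {R : Type*} [DecidableEq R] {γ : G → R} {H : Subgroup G}

theorem HidesSubgroup.productState_mem (hγ : HidesSubgroup γ H) (m : ℕ) :
    productState (fun _ => graphState γ) ∈ invariantStates R m H := by
  intro t ht s
  simp only [productState_apply, rightShift_apply, graphState]
  refine Finset.prod_congr rfl fun i _ => ?_
  have h : γ ((s i).1 * t i) = γ (s i).1 := ((hγ _ _).mpr (by simpa using ht i)).symm
  simp only [h]

/-- If `K` is not contained in the hidden subgroup, the coset states are exponentially close to
orthogonal to the `K`-invariant states. -/
theorem HidesSubgroup.norm_starProjection_le [Fintype R] (hγ : HidesSubgroup γ H) (m : ℕ) {K : Subgroup G}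
    (hK : ¬ K ≤ H) :
    2 ^ m * ‖(invariantStates R m K).starProjection (productState fun _ => graphState γ)‖ ^ 2
      ≤ 1 := by
  obtain ⟨k, hkK, hkH⟩ := SetLike.not_le_iff_exists.mp hK
  set φ : EuclideanSpace ℂ (Fin m → G × R) := productState fun _ => graphState γ with hφ
  let t : (Fin m → Bool) → Fin m → G := fun e i => if e i then k else 1
  let ψ : (Fin m → Bool) → EuclideanSpace ℂ (Fin m → G × R) :=
    fun e => WithLp.toLp 2 fun s => φ (rightShift R (t e) s)
  have hψ : ∀ e s, ψ e s = φ (rightShift R (t e) s) := fun _ _ => rfl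
  have horth : Orthonormal ℂ ψ := by
    constructor
    · intro e
      rw [← norm_productState (fun _ : Fin m => graphState γ)
        (fun _ => sum_norm_sq_graphState γ), ← hφ,
        ← sq_eq_sq₀ (norm_nonneg _) (norm_nonneg _), EuclideanSpace.norm_sq_eq,
        EuclideanSpace.norm_sq_eq]
      simp only [hψ]
      exact Equiv.sum_comp (rightShift R (t e)) fun s => ‖φ s‖ ^ 2
    · intro e f hef
      obtain ⟨i, hi⟩ := Function.ne_iff.mp hef
      rw [PiLp.inner_apply]
      refine Finset.sum_eq_zero fun s _ => ?_
      have key : γ ((s i).1 * t e i) ≠ (s i).2 ∨ γ ((s i).1 * t f i) ≠ (s i).2 := by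
        by_contra! hcon
        have h := (hγ _ _).mp (hcon.1.trans hcon.2.symm)
        have h' : (t e i)⁻¹ * t f i ∈ H := by
          simpa [mul_assoc] using h
        simp only [t] at h'
        -- Equal bits contradict `hi`; different bits put `k` or its inverse in `H`.
        cases he : e i <;> cases hf : f i <;> simp_all
      have hzero : ∀ e : Fin m → Bool, γ ((s i).1 * t e i) ≠ (s i).2 → ψ e s = 0 := by
        intro e he
        rw [hψ, hφ, productState_apply]
        refine Finset.prod_eq_zero (Finset.mem_univ i) ?_
        simp [graphState, rightShift_apply, he]
      rcases key with h | h <;> simp [hzero _ h]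
  have h := card_mul_norm_sq_starProjection_le (invariantStates R m K) φ ψ horth (by
    intro e y hy
    rw [PiLp.inner_apply, PiLp.inner_apply,
      ← Equiv.sum_comp (rightShift R (t e)) fun s => inner ℂ (φ s) (y s)]
    refine Finset.sum_congr rfl fun s _ => ?_
    rw [hψ, hy (t e) (fun i => by simp only [t]; split_ifs <;> simp [hkK, K.one_mem]) s])
  simpa using h

end Invariant

/-! ### The algorithm -/

/-- An enumeration of the subgroups of a finite group by decreasing order. -/
theorem exists_subgroup_enumeration (G : Type*) [Group G] [Finite G] :
    ∃ K : ℕ → Subgroup G, ∀ H, ∃ j < Nat.card (Subgroup G), K j = H ∧ ∀ i < j, ¬ K i ≤ H := by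
  let e := (Finite.equivFin (Subgroup G)).symm
  let f : Fin (Nat.card (Subgroup G)) → ℕᵒᵈ := fun i => OrderDual.toDual (Nat.card (e i))
  let K' := fun i => e (Tuple.sort f i)
  have hK' : ∀ i j, i ≤ j → Nat.card (K' j) ≤ Nat.card (K' i) :=
    fun i j hij => Tuple.monotone_sort f hij
  have hinj : Function.Injective K' := e.injective.comp (Tuple.sort f).injective
  -- The value `⊥` beyond the range is a mere filler.
  refine ⟨fun j => if h : j < _ then K' ⟨j, h⟩ else ⊥, fun H => ?_⟩
  obtain ⟨⟨j, hj⟩, rfl⟩ : ∃ j, K' j = H := by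
    obtain ⟨a, ha⟩ := e.surjective H
    exact ⟨(Tuple.sort f).symm a, by simp [K', ha]⟩
  refine ⟨j, hj, by simp [hj], fun i hij hle => ?_⟩
  have hi : i < Nat.card (Subgroup G) := hij.trans hj
  simp only [hi, dif_pos] at hle
  have h := Subgroup.eq_of_le_of_card_ge hle (hK' ⟨i, hi⟩ ⟨j, hj⟩ hij.le)
  have := hinj h
  simp at this
  omega

/-- The hidden subgroup problem for a finite group `G` can be solved with `p + 1` evaluations up to
an error that is exponentially small in `p`, times the number of subgroups of `G`. -/
theorem exists_hiddenSubgroup_algorithm {G : Type} [Group G] [Fintype G] [DecidableEq G]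
    (R : Type*) [Fintype R] [DecidableEq R] (r₀ : R) (p : ℕ) :
    ∃ A : QuantumQueryAlgorithm G R (Set G), A.queries = p + 1 ∧
      ∀ (γ : G → R) (H : Subgroup G), HidesSubgroup γ H →
        ∀ U : Matrix (G × R) (G × R) ℂ, IsEvaluationOracle γ r₀ U →
          1 - 2 * (Nat.card (Subgroup G) * √((2 ^ (p + 1))⁻¹))
            ≤ A.prob U {X | Subgroup.closure X = H} := by
  obtain ⟨K, hK⟩ := exists_subgroup_enumeration G
  set n := Nat.card (Subgroup G) with hn
  let S : ℕ → Submodule ℂ (EuclideanSpace ℂ (Fin (p + 1) → G × R)) :=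
    fun j => invariantStates R (p + 1) (K j)
  let μ : G × R → ℂ := graphState fun _ => r₀
  have hμ : ∑ y, ‖μ y‖ ^ 2 = 1 := sum_norm_sq_graphState _
  -- `J` attaches a blank query and outcome `0`; `T` records the measurement outcome. A unitary
  -- taking `J` to `T` performs the sequential measurement coherently.
  let J := krausIsometry (ι := Fin (p + 1) → G × R) μ hμ
    (fun a : Fin (n + 1) => if a = 0 then LinearMap.id else 0) (fun x => by
      rw [Finset.sum_eq_single 0] <;> simp +contextual)
  have hJ : ∀ F, (J (productState F)).ofLp = registerState 0 μ F := by
    intro F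
    ext z
    rw [krausIsometry_apply, registerState]
    split_ifs <;> simp [productState_apply]
  let y₀ : G × R := (1, r₀)
  let T := krausIsometry (Pi.single y₀ 1 : G × R → ℂ) (by
      rw [Finset.sum_eq_single y₀] <;> simp +contextual)
    (fun a : Fin (n + 1) => sequentialKraus S n a) (sum_norm_sq_sequentialKraus S n)
  obtain ⟨W, hW⟩ := exists_unitary_mulVec_eq J T
  choose swap hswap using fun i : Fin (p + 1) =>
    exists_unitary_mulVec_comp (swapRegister (B := G × R) (Fin (n + 1)) i)
  let z₀ : (G × R) × ((Fin (p + 1) → G × R) × Fin (n + 1)) := (y₀, (fun _ => y₀, 0))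
  obtain ⟨prep, hprep⟩ := exists_unitary_mulVec_single z₀ (registerState 0 μ fun _ => μ) (by
    rw [← hJ, ← EuclideanSpace.norm_sq_eq, J.norm_map, norm_productState _ fun _ => hμ, one_pow])
  let A : QuantumQueryAlgorithm G R (Set G) :=
    { work := (Fin (p + 1) → G × R) × Fin (n + 1)
      queries := p + 1
      start := z₀
      -- Gate `k` stores the `k`-th answer in register `k - 1`; the last gate also applies the
      -- measurement.
      gate := fun k => if k = 0 then prep else if k < p + 1 then swap (Fin.ofNat (p + 1) (k - 1))
        else W * swap (Fin.last p)
      out := fun z => K z.2.2 }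
  refine ⟨A, rfl, fun γ H hγ U hU => ?_⟩
  have hquery : ∀ F, (U ⊗ₖ (1 : Matrix A.work A.work ℂ)) *ᵥ registerState 0 μ F
      = registerState 0 (graphState γ) F := by
    intro F
    rw [← hU.mulVec_graphState]
    exact kronecker_mulVec_registerState _ _ _ _
  let F : ℕ → Fin (p + 1) → G × R → ℂ := fun k i => if i.1 < k then graphState γ else μ
  have hF : ∀ k (i : Fin (p + 1)), i.1 = k →
      (swap i).1 *ᵥ registerState 0 (graphState γ) (F k) = registerState 0 μ (F (k + 1)) := by
    intro k i hi
    rw [hswap, registerState_comp_swapRegister]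
    congr 1
    · simp [F, hi]
    · ext j : 1
      by_cases hj : j = i
      · subst hj
        simp [F, hi]
      · have : j.1 ≠ k := fun h => hj (Fin.ext (h.trans hi.symm))
        have h2 : j.1 < k + 1 ↔ j.1 < k := by omega
        simp [F, hj, h2]
  have hstate : ∀ k < p + 1, A.state U k = registerState 0 μ (F k) := by
    intro k
    induction k with
    | zero =>
      intro _
      have hF0 : F 0 = fun _ => μ := by
        ext i : 1
        simp [F]
      rw [hF0]
      exact hprep
    | succ k ih =>
      intro hk
      have hg : A.gate (k + 1) = swap (Fin.ofNat (p + 1) k) := by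
        simp only [A, hk, if_true, Nat.succ_ne_zero, if_false, Nat.add_sub_cancel]
      rw [QuantumQueryAlgorithm.state, ih (by omega), hquery, hg]
      exact hF k _ (Nat.mod_eq_of_lt (by omega))
  have hfinal : A.state U A.queries = (T (productState fun _ => graphState γ)).ofLp := by
    have hg : A.gate (p + 1) = W * swap (Fin.last p) := by simp [A]
    change A.state U (p + 1) = _
    rw [QuantumQueryAlgorithm.state, hstate p (by omega), hquery, hg, ← hW, hJ]
    have h2 : F (p + 1) = fun _ => graphState γ := by
      ext i : 1
      simp [F, i.2]
    rw [← h2, ← hF p (Fin.last p) rfl]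
    exact (Matrix.mulVec_mulVec _ _ _).symm
  obtain ⟨j, hj, hKj, hlt⟩ := hK H
  set φ : EuclideanSpace ℂ (Fin (p + 1) → G × R) := productState fun _ => graphState γ with hφ
  have hmeas := one_sub_le_norm_sq_sequentialKraus S φ
    (norm_productState _ fun _ => sum_norm_sq_graphState γ) √((2 ^ (p + 1))⁻¹) hj
    (by simpa only [S, hKj] using hγ.productState_mem (p + 1)) (fun i hi => by
      refine Real.le_sqrt_of_sq_le ?_
      have h := hγ.norm_starProjection_le (p + 1) (hlt i hi)
      rw [← one_div, le_div_iff₀ (by positivity), mul_comm]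
      exact h)
  have hprob : ‖sequentialKraus S n j φ‖ ^ 2 ≤ A.prob U {X | Subgroup.closure X = H} := by
    let a : Fin (n + 1) := ⟨j, by omega⟩
    -- The basis states with outcome `j` and query register `y₀` alone carry enough probability.
    let ι : (Fin (p + 1) → G × R) → (G × R) × A.work := fun s => (y₀, (s, a))
    have hι : Function.Injective ι := fun s s' h => congrArg (fun z => z.2.1) h
    rw [EuclideanSpace.norm_sq_eq, QuantumQueryAlgorithm.prob, hfinal]
    calc _ = ∑ s, (A.out ⁻¹' {X | Subgroup.closure X = H}).indicator
          (fun z => ‖T φ z‖ ^ 2) (ι s) := by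
            refine Finset.sum_congr rfl fun s _ => ?_
            rw [Set.indicator_of_mem (by simp [A, ι, a, hKj])]
            rw [krausIsometry_apply]
            simp [ι, a]
      _ = ∑ z ∈ Finset.univ.map ⟨ι, hι⟩, (A.out ⁻¹' {X | Subgroup.closure X = H}).indicator
          (fun z => ‖T φ z‖ ^ 2) z := by rw [Finset.sum_map]; rfl
      _ ≤ _ := Finset.sum_le_sum_of_subset_of_nonneg (Finset.subset_univ _)
          fun z _ _ => Set.indicator_nonneg (fun _ _ => by positivity) z
  refine le_trans ?_ (hmeas.trans hprob)
  have : (j : ℝ) ≤ n := by exact_mod_cast hj.le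
  have := mul_le_mul_of_nonneg_right this (Real.sqrt_nonneg ((2 ^ (p + 1))⁻¹))
  linarith

/-! ### Subgroups of dihedral groups, and the number of queries -/

/-- Every subgroup of a dihedral group is generated by two elements. -/
theorem DihedralGroup.exists_closure_pair_eq {N : ℕ} (H : Subgroup (DihedralGroup N)) :
    ∃ a b, Subgroup.closure {a, b} = H := by
  -- The rotations in `H` form a subgroup of a cyclic group, hence have one generator; a single
  -- reflection accounts for all others.
  let Z : AddSubgroup (ZMod N) :=
    { carrier := {i | r i ∈ H}
      zero_mem' := by simp
      add_mem' := fun {i j} hi hj => by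
        have := H.mul_mem hi hj
        simpa using this
      neg_mem' := fun {i} hi => by
        have := H.inv_mem hi
        simpa using this }
  obtain ⟨⟨d, hd⟩, hgen⟩ := IsAddCyclic.exists_generator (α := Z)
  have hdH : r d ∈ H := hd
  have hr : ∀ i, r i ∈ H → ∀ b, r i ∈ Subgroup.closure {r d, b} := by
    intro i hi b
    obtain ⟨k, hk⟩ := AddSubgroup.mem_zmultiples_iff.mp (hgen ⟨i, hi⟩)
    have hk' : k • d = i := congrArg Subtype.val hk
    have : r i = (r d) ^ k := by
      rw [← hk', DihedralGroup.r_zpow]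
      simp [mul_comm]
    rw [this]
    exact Subgroup.zpow_mem _ (Subgroup.subset_closure (by simp)) k
  by_cases hs : ∃ i, sr i ∈ H
  · obtain ⟨i, hi⟩ := hs
    refine ⟨r d, sr i, le_antisymm ?_ ?_⟩
    · rw [Subgroup.closure_le]
      rintro x (rfl | rfl)
      · exact hdH
      · exact hi
    · rintro (j | j) hj
      · exact hr j hj _
      · have h1 : sr i * sr j ∈ H := H.mul_mem hi hj
        rw [sr_mul_sr] at h1
        have h2 : sr j = sr i * r (j - i) := by simp
        rw [h2]
        exact Subgroup.mul_mem _ (Subgroup.subset_closure (by simp)) (hr _ h1 _)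
  · push Not at hs
    refine ⟨r d, 1, le_antisymm ?_ ?_⟩
    · rw [Subgroup.closure_le]
      rintro x (rfl | rfl)
      · exact hdH
      · exact H.one_mem
    · rintro (j | j) hj
      · exact hr j hj _
      · exact absurd hj (hs j)

theorem DihedralGroup.card_subgroup_le (N : ℕ) [NeZero N] :
    Nat.card (Subgroup (DihedralGroup N)) ≤ (2 * N) ^ 2 := by
  have hsurj : Function.Surjective
      (fun p : DihedralGroup N × DihedralGroup N => Subgroup.closure {p.1, p.2}) := by
    intro H
    obtain ⟨a, b, h⟩ := exists_closure_pair_eq H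
    exact ⟨(a, b), h⟩
  refine (Nat.card_le_card_of_surjective _ hsurj).trans ?_
  rw [Nat.card_prod, Nat.card_eq_fintype_card, DihedralGroup.card, sq]

/-- For `N ≥ 2` both logarithms are bounded below by positive constants, which absorbs `b` and the
rounding. -/
theorem isTheta_natLog (a b : ℕ) (ha : 0 < a) :
    (fun N : ℕ => ((a * Nat.log 2 N + b : ℕ) : ℝ)) =Θ[Filter.atTop]
      (fun N : ℕ => Real.log (N : ℝ)) := by
  have hl2 : 0 < Real.log 2 := Real.log_pos (by norm_num)
  constructor
  · refine Asymptotics.IsBigO.of_bound ((a + b) / Real.log 2) ?_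
    filter_upwards [Filter.eventually_ge_atTop 2] with N hN
    have h1 : (Nat.log 2 N : ℝ) ≤ Real.log N / Real.log 2 := by
      simpa [Real.logb] using Real.natLog_le_logb N 2
    have h2 : (1 : ℝ) ≤ Real.log N / Real.log 2 := by
      rw [le_div_iff₀ hl2, one_mul]
      exact Real.log_le_log (by norm_num) (by exact_mod_cast hN)
    have h3 : 0 ≤ Real.log N := Real.log_natCast_nonneg N
    rw [Real.norm_of_nonneg (by positivity), Real.norm_of_nonneg h3]
    have e : (a + b) / Real.log 2 * Real.log N = a * (Real.log N / Real.log 2)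
        + b * (Real.log N / Real.log 2) := by ring
    rw [e]
    push_cast
    have := mul_le_mul_of_nonneg_left h1 (Nat.cast_nonneg (α := ℝ) a)
    have := mul_le_mul_of_nonneg_left h2 (Nat.cast_nonneg (α := ℝ) b)
    linarith
  · refine Asymptotics.IsBigO.of_bound (2 * Real.log 2) ?_
    filter_upwards [Filter.eventually_ge_atTop 2] with N hN
    have h3 : 0 ≤ Real.log N := Real.log_natCast_nonneg N
    have h1 : Real.log N ≤ (Nat.log 2 N + 1) * Real.log 2 := by
      have h : (N : ℝ) ≤ 2 ^ (Nat.log 2 N + 1) := by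
        exact_mod_cast (Nat.lt_pow_succ_log_self (by norm_num) N).le
      have h' := Real.log_le_log (by positivity) h
      rw [Real.log_pow] at h'
      exact_mod_cast h'
    have h2 : (1 : ℝ) ≤ Nat.log 2 N := by
      exact_mod_cast Nat.log_pos (by norm_num) hN
    have h4 : (Nat.log 2 N : ℝ) ≤ ((a * Nat.log 2 N + b : ℕ) : ℝ) := by
      exact_mod_cast (Nat.le_mul_of_pos_left _ ha).trans (Nat.le_add_right _ b)
    rw [Real.norm_of_nonneg h3, Real.norm_of_nonneg (Nat.cast_nonneg _)]
    nlinarith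

theorem theorem2 :
    ∃ q : ℕ → ℕ,
      ((fun N : ℕ => (q N : ℝ)) =Θ[Filter.atTop] (fun N : ℕ => Real.log (N : ℝ))) ∧
      ∀ (N : ℕ) [NeZero N] (R : Type*) [Fintype R] [DecidableEq R] (r₀ : R),
        ∃ A : QuantumQueryAlgorithm (DihedralGroup N) R (Set (DihedralGroup N)),
          A.queries = q N ∧
          ∀ (γ : DihedralGroup N → R) (H : Subgroup (DihedralGroup N)),
            HidesSubgroup γ H →
            ∀ U : Matrix (DihedralGroup N × R) (DihedralGroup N × R) ℂ,
              IsEvaluationOracle γ r₀ U →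
              1 - 2 / (N : ℝ) ≤ A.prob U {X | Subgroup.closure X = H} := by
  -- With `m = 6 * l + 10`, `2 ^ (m / 2) = 4 * (2 ^ (l + 1)) ^ 3 ≥ 4 * N ^ 3`; against at most `4 *
  -- N ^ 2` subgroups this leaves error `2 / N`.
  refine ⟨fun N => 6 * Nat.log 2 N + 10, isTheta_natLog 6 10 (by norm_num), ?_⟩
  intro N _ R _ _ r₀
  obtain ⟨A, hA, hprob⟩ := exists_hiddenSubgroup_algorithm (G := DihedralGroup N) R r₀
    (6 * Nat.log 2 N + 9)
  refine ⟨A, hA, fun γ H hγ U hU => le_trans ?_ (hprob γ H hγ U hU)⟩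
  have hN : (0 : ℝ) < N := by exact_mod_cast NeZero.pos N
  set n := Nat.card (Subgroup (DihedralGroup N))
  set l := Nat.log 2 N with hl
  have hn : (n : ℝ) ≤ (2 * N) ^ 2 := by exact_mod_cast DihedralGroup.card_subgroup_le N
  have hNl : (N : ℝ) ≤ 2 ^ (l + 1) := by
    exact_mod_cast (Nat.lt_pow_succ_log_self (by norm_num) N).le
  have hsqrt : √((2 ^ (6 * l + 9 + 1))⁻¹ : ℝ) = (2 ^ (3 * l + 5))⁻¹ := by
    rw [show (2 : ℝ) ^ (6 * l + 9 + 1) = (2 ^ (3 * l + 5)) ^ 2 by rw [← pow_mul]; ring_nf,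
      ← inv_pow, Real.sqrt_sq (by positivity)]
  have hpow : (4 : ℝ) * N ^ 3 ≤ 2 ^ (3 * l + 5) := by
    calc (4 : ℝ) * N ^ 3 ≤ 4 * (2 ^ (l + 1)) ^ 3 := by gcongr
      _ = 2 ^ (3 * l + 5) := by ring
  have key : n * (2 ^ (3 * l + 5) : ℝ)⁻¹ ≤ 1 / N := by
    rw [← div_eq_mul_inv, div_le_div_iff₀ (by positivity) hN]
    calc (n : ℝ) * N ≤ (2 * N) ^ 2 * N := by gcongr
      _ = 4 * N ^ 3 := by ring
      _ ≤ 1 * 2 ^ (3 * l + 5) := by rw [one_mul]; exact hpow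
  rw [hsqrt]
  have : 2 / (N : ℝ) = 2 * (1 / N) := by ring
  linarith
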